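/- Let $\mathsf A,\mathsf B,\mathsf B'$ be finite-dimensional quantum systems with distinguished computational basis states $|0\rangle$. A unitary operator $U$ on $\mathsf A\otimes\mathsf B$ is said to give purified query access to a pure state $|\varphi\rangle$ of $\mathsf A$ if tracing out $\mathsf B$ from the state that $U$ prepares leaves $|\varphi\rangle$, i.e. $\operatorname{Tr}_{\mathsf B}\bigl(|\Phi\rangle\langle\Phi|\bigr)=|\varphi\rangle\langle\varphi|$ where $|\Phi\rangle=U|0\rangle_{\mathsf A}|0\rangle_{\mathsf B}$. A quantum query algorithm with access to unitary oracles $U$ and $V$ starts in a computational basis state of a finite-dimensional workspace, applies a finite sequence of steps, each of which is either a unitary gate that does not depend on the oracles or one query to $U$, $V$, controlled-$U$, controlled-$V$ or the inverse of one of these, then measures the workspace in the computational basis and outputs a real number computed from the outcome. Its query complexity is the total number of queries. There is a universal constant $C>0$ such that, for all such systems $\mathsf A,\mathsf B,\mathsf B'$ and every $\varepsilon\in(0,1)$, there is a quantum query algorithm that makes at most $C/\varepsilon$ queries and has the following property. For all pure states $|\varphi\rangle,|\psi\rangle$ of $\mathsf A$, every unitary $U$ on $\mathsf A\otimes\mathsf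 B$ that gives purified query access to $|\varphi\rangle$, and every unitary $V$ on $\mathsf A\otimes\mathsf B'$ that gives purified query access to $|\psi\rangle$, when run with the oracles $U$ and $V$ the algorithm outputs, with probability at least $2/3$, a number $\tilde x$ with $\bigl|\tilde x-|\langle\varphi|\psi\rangle|\bigr|<\varepsilon$. -/

import Mathlib

open scoped Matrix Kronecker

noncomputable section

namespace PureFidelity

/-- The partial trace over the second subsystem, `Tr_B`. -/
def partialTrace {A B : Type} [Fintype B] (M : Matrix (A × B) (A × B) ℂ) : Matrix A A ℂ :=
  Matrix.of fun i j => ∑ b, M (i, b) (j, b)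

/-- The rank-one operator `|v⟩⟨v|`. -/
def ketbra {X : Type} (v : X → ℂ) : Matrix X X ℂ :=
  Matrix.vecMulVec v (star v)

/-- `U` gives purified query access to the pure state `|φ⟩` of the system `A`, where `B` is the
system of the redundant output registers: tracing out `B` from the pure state `U |0⟩_A |0⟩_B`
leaves `|φ⟩⟨φ|`. The computational basis vector `|0⟩` of `A` (of `B`) is the one with the label
`a₀` (`b₀`). -/
def PreparesPurificationOf {A B : Type} [Fintype A] [DecidableEq A] [Fintype B] [DecidableEq B]
    (a₀ : A) (b₀ : B) (U : Matrix.unitaryGroup (A × B) ℂ) (φ : EuclideanSpace ℂ A) : Prop :=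
  partialTrace (ketbra ((U : Matrix (A × B) (A × B) ℂ) *ᵥ Pi.single (a₀, b₀) 1)) = ketbra φ.ofLp

/-- The fidelity `|⟨φ|ψ⟩|` of two pure states. -/
def fidelity {A : Type} [Fintype A] (φ ψ : EuclideanSpace ℂ A) : ℝ :=
  ‖inner ℂ φ ψ‖

/-- The controlled version of `M`: the control qubit is the second factor; `M` is applied if it is
`true` (that is, `|1⟩`), and the identity is applied if it is `false` (that is, `|0⟩`). -/
def controlled {X : Type} [DecidableEq X] (M : Matrix X X ℂ) :
    Matrix (X × Bool) (X × Bool) ℂ :=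
  Matrix.blockDiagonal fun c : Bool => if c then M else 1

/-- `M` applied to the register `X` of the workspace `W`, where `e` splits the basis labels of `W`
into those of `X` and those of the remaining registers `R`: the operator `M ⊗ I_R`. -/
def applyOn {X R W : Type} [DecidableEq R] (e : W ≃ X × R) (M : Matrix X X ℂ) : Matrix W W ℂ :=
  Matrix.reindex e.symm e.symm (M ⊗ₖ (1 : Matrix R R ℂ))

/-- The oracle `M` if `inv = false`, its inverse `M† = M⁻¹` if `inv = true`. -/
def oracle {X : Type} [Fintype X] [DecidableEq X] (inv : Bool) (M : Matrix.unitaryGroup X ℂ) :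
    Matrix X X ℂ :=
  ((if inv then M⁻¹ else M : Matrix.unitaryGroup X ℂ) : Matrix X X ℂ)

/-- One step of a quantum query algorithm on a workspace with basis labels `W`, with access to an
oracle `U` on the system `X` and an oracle `V` on the system `Y`: either a unitary gate that does
not depend on the oracles, or one query to (controlled-)`U`, (controlled-)`V` or one of their
inverses, on some registers of the workspace. -/
inductive Step (X Y W : Type) [Fintype W] [DecidableEq W] : Type 1
  | gate (G : Matrix.unitaryGroup W ℂ)
  | queryU (inv : Bool) (R : Type) [Fintype R] [DecidableEq R] (e : W ≃ X × R)
  | queryV (inv : Bool) (R : Type) [Fintype R] [DecidableEq R] (e : W ≃ Y × R)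
  | ctrlQueryU (inv : Bool) (R : Type) [Fintype R] [DecidableEq R] (e : W ≃ (X × Bool) × R)
  | ctrlQueryV (inv : Bool) (R : Type) [Fintype R] [DecidableEq R] (e : W ≃ (Y × Bool) × R)

namespace Step

variable {X Y W : Type} [Fintype X] [DecidableEq X] [Fintype Y] [DecidableEq Y]
  [Fintype W] [DecidableEq W]

/-- The operator on the workspace that a step performs for the oracles `U` and `V`. -/
def toMatrix (U : Matrix.unitaryGroup X ℂ) (V : Matrix.unitaryGroup Y ℂ) :
    Step X Y W → Matrix W W ℂ
  | gate G => (G : Matrix W W ℂ)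
  | queryU inv _ e => applyOn e (oracle inv U)
  | queryV inv _ e => applyOn e (oracle inv V)
  | ctrlQueryU inv _ e => applyOn e (controlled (oracle inv U))
  | ctrlQueryV inv _ e => applyOn e (controlled (oracle inv V))

/-- The number of oracle queries that a step makes. -/
def queries : Step X Y W → ℕ
  | gate _ => 0
  | queryU _ _ _ => 1
  | queryV _ _ _ => 1
  | ctrlQueryU _ _ _ => 1
  | ctrlQueryV _ _ _ => 1

end Step

/-- A quantum query algorithm with a real-valued output and with access to an oracle on the system
`X` and an oracle on the system `Y`. It starts in a computational basis state of its finite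
dimensional workspace, performs its steps in order, measures the workspace in the computational
basis, and outputs a real number that is computed from the outcome. Nothing in it depends on the
oracles. -/
structure QueryAlgorithm (X Y : Type) : Type 1 where
  /-- The labels of the computational basis of the workspace. -/
  W : Type
  fintypeW : Fintype W
  decEqW : DecidableEq W
  /-- The label of the initial state. -/
  init : W
  /-- The steps, the first one at the head of the list. -/
  steps : List (Step X Y W)
  /-- The classical postprocessing of the measurement outcome. -/
  output : W → ℝ

namespace QueryAlgorithm

attribute [instance] QueryAlgorithm.fintypeW QueryAlgorithm.decEqW

variable {X Y : Type} [Fintype X] [DecidableEq X] [Fintype Y] [DecidableEq Y]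

/-- The number of queries, to (controlled-)`U`, (controlled-)`V` and their inverses in total. -/
def queryCount (𝒜 : QueryAlgorithm X Y) : ℕ :=
  (𝒜.steps.map Step.queries).sum

/-- The state of the workspace before the measurement, for the oracles `U` and `V`. -/
def finalState (𝒜 : QueryAlgorithm X Y) (U : Matrix.unitaryGroup X ℂ)
    (V : Matrix.unitaryGroup Y ℂ) : 𝒜.W → ℂ :=
  𝒜.steps.foldl (fun v s => s.toMatrix U V *ᵥ v) (Pi.single 𝒜.init 1)

/-- The probability that the output lies in `S`, for the oracles `U` and `V` (Born rule). -/
def prob (𝒜 : QueryAlgorithm X Y) (U : Matrix.unitaryGroup X ℂ) (V : Matrix.unitaryGroup Y ℂ)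
    (S : Set ℝ) : ℝ :=
  ∑ w, (𝒜.output ⁻¹' S).indicator (fun w => ‖𝒜.finalState U V w‖ ^ 2) w

end QueryAlgorithm

end PureFidelity

end

/-! The circuit `P = U† · SWAP · V · U` turns fidelity into an amplitude. Started in the all-zero
state, it leaves the first register in its zero state with amplitude `φ a * ∑ c, star (φ c) * V (c,
b')` along `(a, b')`: contracting the purifying register `B` between `U` and `U†` produces the
entries of `|φ⟩⟨φ|`. The total weight there is `F ^ 2`, where `F` is the fidelity
(`sum_norm_overlap_sq`). Estimating `F` is thus amplitude estimation for `P`.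

Let `s` be the initial state and `G = P† Z P`, with `Z` the sign flip on the good subspace. Then
`⟨s, G s⟩ = 1 - 2 F ^ 2`, and `s` is a sum of orthogonal eigenvectors of `(2 |s⟩⟨s| - 1) G`, each
with an eigenvalue of modulus 1 and real part `1 - 2 F ^ 2` (`exists_eigen_decomposition`). Writing
such an eigenvalue as `exp (2 i θ)` gives `F = |sin θ|`.

Phase estimation uses a sine-shaped control state. The outcome `y` then satisfies `E[exp (2πi y /
N)] = μ cos (π / N)` exactly (`sum_norm_kernel_sq_mul_char`), so the mean square error of `|sin (π y
/ N)|` is at most `(1 - cos (π / N)) / 2 = O(1 / N ^ 2)` (`sum_kernel_error_le`). Markov's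
inequality with `N` of order `1 / ε` concludes, each of the `N` Grover rounds costing six queries.
-/

open scoped Matrix Kronecker

noncomputable section

namespace PhaseEstimation

open Finset

/-! ### Sine amplitudes on `ZMod N` and their correlation with a unit shift. -/

section SineState

variable {N : ℕ}

/-- The unnormalised amplitudes of the sine state. -/
def sineTable (j : ZMod N) : ℝ := Real.sin (Real.pi * j.val / N)

theorem sineTable_zero : sineTable (0 : ZMod N) = 0 := by
  simp [sineTable]

variable [NeZero N]

theorem val_add_one_cases (j : ZMod N) :
    (j + 1).val = j.val + 1 ∨ (j.val + 1 = N ∧ j + 1 = 0) := by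
  have h0 : j + 1 = ((j.val + 1 : ℕ) : ZMod N) := by simp
  have hlt : j.val < N := ZMod.val_lt j
  rcases Nat.lt_or_ge (j.val + 1) N with h | h
  · left
    rw [h0, ZMod.val_natCast, Nat.mod_eq_of_lt h]
  · right
    have h1 : j.val + 1 = N := by omega
    refine ⟨h1, ?_⟩
    rw [h0, h1, ZMod.natCast_self]

theorem sineTable_add_one (j : ZMod N) :
    sineTable (j + 1) = Real.sin (Real.pi * j.val / N + Real.pi / N) := by
  have hN : (N : ℝ) ≠ 0 := Nat.cast_ne_zero.2 (NeZero.ne N)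
  rcases val_add_one_cases j with h | ⟨h, h'⟩
  · rw [sineTable, h]
    congr 1
    push_cast
    ring
  · rw [h', sineTable_zero]
    have : Real.pi * j.val / N + Real.pi / N = Real.pi := by
      have h2 : (j.val : ℝ) = N - 1 := by
        have h3 := congrArg (Nat.cast : ℕ → ℝ) h
        push_cast at h3
        linarith
      rw [h2]
      field_simp
      ring
    rw [this, Real.sin_pi]

theorem sineTable_mul_pred (j : ZMod N) :
    sineTable (j + 1) * sineTable j
      = sineTable (j + 1) * Real.sin (Real.pi * (j + 1).val / N - Real.pi / N) := by
  rcases val_add_one_cases j with h | ⟨h, h'⟩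
  · congr 1
    rw [h, sineTable]
    congr 1
    push_cast
    ring
  · rw [h', sineTable_zero, zero_mul, zero_mul]

/-- The identity `sin (x + h) + sin (x - h) = 2 sin x cos h`, summed over one period. The
wrap-around from `N - 1` to `0` does no harm because the table vanishes at `0`. -/
theorem sum_sineTable_mul_succ :
    ∑ j : ZMod N, sineTable (j + 1) * sineTable j
      = Real.cos (Real.pi / N) * ∑ j : ZMod N, sineTable j ^ 2 := by
  have h1 : ∑ j : ZMod N, sineTable (j + 1) * sineTable j
      = ∑ j : ZMod N, sineTable j * Real.sin (Real.pi * j.val / N - Real.pi / N) := by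
    rw [← Equiv.sum_comp (Equiv.addRight (1 : ZMod N))
      (fun j => sineTable j * Real.sin (Real.pi * j.val / N - Real.pi / N))]
    exact Finset.sum_congr rfl fun j _ => sineTable_mul_pred j
  have h2 : ∑ j : ZMod N, sineTable (j + 1) * sineTable j
      = ∑ j : ZMod N, sineTable j * Real.sin (Real.pi * j.val / N + Real.pi / N) :=
    Finset.sum_congr rfl fun j _ => by rw [sineTable_add_one, mul_comm]
  have h3 : 2 * ∑ j : ZMod N, sineTable (j + 1) * sineTable j
      = 2 * (Real.cos (Real.pi / N) * ∑ j : ZMod N, sineTable j ^ 2) := by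
    rw [two_mul]
    nth_rewrite 1 [h1]
    rw [h2, ← Finset.sum_add_distrib, Finset.mul_sum, Finset.mul_sum]
    refine Finset.sum_congr rfl fun j _ => ?_
    rw [Real.sin_sub, Real.sin_add, sineTable]
    ring
  linarith

theorem sum_sineTable_sq_pos (hN : 2 ≤ N) : 0 < ∑ j : ZMod N, sineTable j ^ 2 := by
  have hN0 : (0 : ℝ) < N := by exact_mod_cast (by omega : 0 < N)
  refine Finset.sum_pos' (fun j _ => sq_nonneg _) ⟨((1 : ℕ) : ZMod N), Finset.mem_univ _, ?_⟩
  have : 0 < sineTable ((1 : ℕ) : ZMod N) := by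
    rw [sineTable, ZMod.val_natCast, Nat.mod_eq_of_lt (by omega)]
    refine Real.sin_pos_of_pos_of_lt_pi (by positivity [Real.pi_pos]) ?_
    rw [div_lt_iff₀ hN0]
    have : (2 : ℝ) ≤ N := by exact_mod_cast hN
    push_cast
    nlinarith [Real.pi_pos]
  positivity

/-- The amplitudes of the sine state. -/
def sineAmp (j : ZMod N) : ℝ := sineTable j / √(∑ j : ZMod N, sineTable j ^ 2)

theorem sineAmp_zero : sineAmp (0 : ZMod N) = 0 := by
  simp [sineAmp, sineTable_zero]

theorem sum_sineAmp_sq (hN : 2 ≤ N) : ∑ j : ZMod N, sineAmp j ^ 2 = 1 := by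
  have h := sum_sineTable_sq_pos hN
  simp only [sineAmp, div_pow, Real.sq_sqrt h.le]
  rw [← Finset.sum_div, div_self h.ne']

theorem sum_sineAmp_mul_succ (hN : 2 ≤ N) :
    ∑ j : ZMod N, sineAmp (j + 1) * sineAmp j = Real.cos (Real.pi / N) := by
  have h := sum_sineTable_sq_pos hN
  simp only [sineAmp, div_mul_div_comm, Real.mul_self_sqrt h.le]
  rw [← Finset.sum_div, sum_sineTable_mul_succ, mul_div_assoc, div_self h.ne', mul_one]

end SineState

/-! ### The Fourier matrix: unitarity and its action on shifts. -/

section Fourier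

variable (N : ℕ) [NeZero N]

/-- The matrix of the inverse quantum Fourier transform. -/
def fourierMatrix : Matrix (ZMod N) (ZMod N) ℂ :=
  Matrix.of fun y j => ((√(N : ℝ))⁻¹ : ℝ) * ZMod.stdAddChar (-(y * j))

variable {N}

theorem star_stdAddChar (j : ZMod N) :
    star (ZMod.stdAddChar j : ℂ) = ZMod.stdAddChar (-j) := by
  rw [AddChar.map_neg_eq_inv, ZMod.stdAddChar_apply, ← Circle.coe_inv, Circle.coe_inv_eq_conj]
  rfl

theorem fourierMatrix_mem : fourierMatrix N ∈ Matrix.unitaryGroup (ZMod N) ℂ := by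
  rw [Matrix.mem_unitaryGroup_iff']
  have hN : (0 : ℝ) < N := Nat.cast_pos.2 (NeZero.pos N)
  ext j k
  rw [Matrix.mul_apply]
  have hterm : ∀ y : ZMod N, (star (fourierMatrix N)) j y * fourierMatrix N y k
      = (N : ℂ)⁻¹ * ZMod.stdAddChar (y * (j - k)) := by
    intro y
    have h1 : (((√(N : ℝ))⁻¹ : ℝ) : ℂ) * (((√(N : ℝ))⁻¹ : ℝ) : ℂ) = (N : ℂ)⁻¹ := by
      rw [← Complex.ofReal_mul, ← mul_inv, Real.mul_self_sqrt hN.le]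
      push_cast; rfl
    have h2 : (ZMod.stdAddChar (y * (j - k)) : ℂ)
        = ZMod.stdAddChar (y * j) * ZMod.stdAddChar (-(y * k)) := by
      rw [← AddChar.map_add_eq_mul]
      congr 1
      ring
    rw [Matrix.star_apply, fourierMatrix, Matrix.of_apply, Matrix.of_apply, star_mul',
      star_stdAddChar, neg_neg, h2, ← h1]
    rw [Complex.star_def, Complex.conj_ofReal]
    ring
  rw [Finset.sum_congr rfl fun y _ => hterm y, ← Finset.mul_sum,
    AddChar.sum_mulShift _ (ZMod.isPrimitive_stdAddChar N), ZMod.card, Matrix.one_apply]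
  have hNC : (N : ℂ) ≠ 0 := by exact_mod_cast NeZero.ne N
  by_cases h : j = k
  · simp [h, hNC]
  · simp [h, sub_eq_zero]

theorem fourierMatrix_mulVec_shift (b : ZMod N → ℂ) (y : ZMod N) :
    (fourierMatrix N *ᵥ fun j => b (j + 1)) y
      = ZMod.stdAddChar y * (fourierMatrix N *ᵥ b) y := by
  simp only [Matrix.mulVec, dotProduct, Finset.mul_sum]
  rw [← Equiv.sum_comp (Equiv.addRight (1 : ZMod N))
    (fun j => ZMod.stdAddChar y * (fourierMatrix N y j * b j))]
  refine Finset.sum_congr rfl fun j _ => ?_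
  simp only [fourierMatrix, Matrix.of_apply, Equiv.coe_addRight]
  have : (ZMod.stdAddChar (-(y * j)) : ℂ)
      = ZMod.stdAddChar y * ZMod.stdAddChar (-(y * (j + 1))) := by
    rw [← AddChar.map_add_eq_mul]
    congr 1
    ring
  rw [this]
  ring

end Fourier

theorem star_mulVec_dotProduct_mulVec {X : Type*} [Fintype X] [DecidableEq X] {M : Matrix X X ℂ}
    (hM : M ∈ Matrix.unitaryGroup X ℂ) (v w : X → ℂ) :
    star (M *ᵥ v) ⬝ᵥ (M *ᵥ w) = star v ⬝ᵥ w := by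
  have h := Matrix.mem_unitaryGroup_iff'.1 hM
  rw [Matrix.star_eq_conjTranspose] at h
  rw [Matrix.star_mulVec, Matrix.dotProduct_mulVec, Matrix.vecMul_vecMul, h, Matrix.vecMul_one]

theorem star_dotProduct_self {X : Type*} [Fintype X] (v : X → ℂ) :
    star v ⬝ᵥ v = ((∑ x, ‖v x‖ ^ 2 : ℝ) : ℂ) := by
  simp only [dotProduct, Pi.star_apply, Complex.star_def, Complex.conj_mul']
  push_cast
  rfl

/-! ### Outcome distribution and mean square error for a single eigenvalue. -/

section Kernel

variable {N : ℕ} [NeZero N]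

/-- The control register after the phase kickback of an eigenvalue `μ` on the sine state. -/
def phaseState (μ : ℂ) (j : ZMod N) : ℂ := sineAmp j * μ ^ j.val

/-- The amplitudes of phase estimation for the eigenvalue `μ`. -/
def kernel (μ : ℂ) : ZMod N → ℂ := fourierMatrix N *ᵥ phaseState μ

theorem sum_norm_kernel_sq (hN : 2 ≤ N) {μ : ℂ} (hμ : ‖μ‖ = 1) :
    ∑ y : ZMod N, ‖kernel μ y‖ ^ 2 = 1 := by
  have h := star_mulVec_dotProduct_mulVec (fourierMatrix_mem (N := N)) (phaseState μ)
    (phaseState μ)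
  rw [star_dotProduct_self, star_dotProduct_self] at h
  rw [kernel, Complex.ofReal_injective h, ← sum_sineAmp_sq hN]
  refine Finset.sum_congr rfl fun j _ => ?_
  rw [phaseState, norm_mul, norm_pow, hμ, one_pow, mul_one, Complex.norm_real, Real.norm_eq_abs,
    sq_abs]

/-- The Fourier matrix turns a shift into multiplication by a character, so by unitarity this first
moment is the inner product of the phase state with its own shift. Each term of that product
contributes a factor `μ`, also at the wrap-around, where the amplitude is zero. -/
theorem sum_norm_kernel_sq_mul_char (hN : 2 ≤ N) {μ : ℂ} (hμ : ‖μ‖ = 1) :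
    ∑ y : ZMod N, ((‖kernel μ y‖ ^ 2 : ℝ) : ℂ) * ZMod.stdAddChar y
      = μ * Real.cos (Real.pi / N) := by
  have h := star_mulVec_dotProduct_mulVec (fourierMatrix_mem (N := N)) (phaseState μ)
    (fun j => phaseState μ (j + 1))
  have h1 : star (fourierMatrix N *ᵥ phaseState μ)
      ⬝ᵥ (fourierMatrix N *ᵥ fun j => phaseState μ (j + 1))
      = ∑ y : ZMod N, ((‖kernel μ y‖ ^ 2 : ℝ) : ℂ) * ZMod.stdAddChar y := by
    refine Finset.sum_congr rfl fun y _ => ?_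
    rw [fourierMatrix_mulVec_shift, Pi.star_apply, Complex.ofReal_pow, ← Complex.conj_mul']
    simp only [kernel, Complex.star_def]
    ring
  rw [← h1, h, ← sum_sineAmp_mul_succ hN, Complex.ofReal_sum, Finset.mul_sum]
  refine Finset.sum_congr rfl fun j _ => ?_
  rw [Pi.star_apply]
  rcases val_add_one_cases j with hj | ⟨-, hj⟩
  · have h2 : star (μ ^ j.val) * μ ^ j.val = 1 := by
      rw [Complex.star_def, Complex.conj_mul', norm_pow, hμ]; simp
    simp only [phaseState, hj, star_mul', pow_succ, Complex.ofReal_mul]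
    rw [Complex.star_def, Complex.conj_ofReal]
    rw [Complex.star_def] at h2
    linear_combination (sineAmp j * sineAmp (j + 1) * μ : ℂ) * h2
  · simp [phaseState, hj, sineAmp_zero]

/-- The estimate of `sin θ` if phase estimation for the eigenvalues `exp (± 2 i θ)` returns `y`. -/
def estimate (y : ZMod N) : ℝ := |Real.sin (Real.pi * y.val / N)|

theorem abs_sub_abs_sin_sq_le (x t : ℝ) :
    (|Real.sin x| - |Real.sin t|) ^ 2 ≤ Real.sin (x - t) ^ 2 := by
  rw [← sq_abs, ← sq_abs (Real.sin (x - t))]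
  have key : ∀ a b : ℝ, |Real.sin a| ≤ |Real.sin (a - b)| + |Real.sin b| := by
    intro a b
    have h : Real.sin a = Real.sin (a - b) * Real.cos b + Real.cos (a - b) * Real.sin b := by
      rw [← Real.sin_add, sub_add_cancel]
    rw [h]
    refine (abs_add_le _ _).trans (add_le_add ?_ ?_)
    · rw [abs_mul]
      exact mul_le_of_le_one_right (abs_nonneg _) (Real.abs_cos_le_one _)
    · rw [abs_mul]
      exact mul_le_of_le_one_left (abs_nonneg _) (Real.abs_cos_le_one _)
  have h1 := key x t
  have h2 := key t x
  have h3 : |Real.sin (t - x)| = |Real.sin (x - t)| := by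
    rw [← neg_sub, Real.sin_neg, abs_neg]
  refine pow_le_pow_left₀ (abs_nonneg _) (abs_le.2 ⟨?_, ?_⟩) 2 <;> linarith

/-- With `μ = exp (2 i s)` one has `F = |sin s|`, and the right side is `sin ^ 2` of the angle `π y
/ N - s`. The absolute values make the sign of `s` irrelevant, so conjugate eigenvalues serve
equally well. The bound is linear in the character, hence its mean needs only the first moment. -/
theorem estimate_sub_sq_le {μ : ℂ} (hμ : ‖μ‖ = 1) {F : ℝ} (hF : 0 ≤ F)
    (hre : μ.re = 1 - 2 * F ^ 2) (y : ZMod N) :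
    (estimate y - F) ^ 2 ≤ (1 - (star μ * ZMod.stdAddChar y).re) / 2 := by
  obtain ⟨t, rfl⟩ := (Complex.norm_eq_one_iff μ).1 hμ
  set s : ℝ := t / 2 with hs
  have ht : t = 2 * s := by rw [hs]; ring
  have hFs : F = |Real.sin s| := by
    rw [Complex.exp_ofReal_mul_I_re, ht, Real.cos_two_mul] at hre
    rw [← abs_of_nonneg hF]
    refine (sq_eq_sq_iff_abs_eq_abs _ _).1 ?_
    nlinarith [Real.sin_sq_add_cos_sq s]
  rw [hFs, estimate]
  refine (abs_sub_abs_sin_sq_le _ _).trans (le_of_eq ?_)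
  have h1 : star (Complex.exp (t * Complex.I)) * (ZMod.stdAddChar y : ℂ)
      = Complex.exp ((2 * (Real.pi * y.val / N - s) : ℝ) * Complex.I) := by
    rw [Complex.star_def, ← Complex.exp_conj, ZMod.stdAddChar_apply, ZMod.toCircle_apply,
      ← Complex.exp_add, ht]
    congr 1
    simp only [map_mul, Complex.conj_ofReal, Complex.conj_I]
    push_cast
    ring
  rw [h1, Complex.exp_ofReal_mul_I_re, Real.cos_two_mul]
  nlinarith [Real.sin_sq_add_cos_sq (Real.pi * y.val / N - s)]

theorem sum_kernel_error_le (hN : 2 ≤ N) {μ : ℂ} (hμ : ‖μ‖ = 1) {F : ℝ} (hF : 0 ≤ F)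
    (hre : μ.re = 1 - 2 * F ^ 2) :
    ∑ y : ZMod N, ‖kernel μ y‖ ^ 2 * (estimate y - F) ^ 2
      ≤ (1 - Real.cos (Real.pi / N)) / 2 := by
  have h1 : ∑ y : ZMod N, ‖kernel μ y‖ ^ 2 * (estimate y - F) ^ 2
      ≤ ∑ y : ZMod N, ‖kernel μ y‖ ^ 2 * ((1 - (star μ * ZMod.stdAddChar y).re) / 2) :=
    Finset.sum_le_sum fun y _ =>
      mul_le_mul_of_nonneg_left (estimate_sub_sq_le hμ hF hre y) (sq_nonneg _)
  refine h1.trans (le_of_eq ?_)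
  have h2 : ∑ y : ZMod N, ‖kernel μ y‖ ^ 2 * (star μ * ZMod.stdAddChar y).re
      = Real.cos (Real.pi / N) := by
    have h3 : star μ * μ = 1 := by
      rw [Complex.star_def, Complex.conj_mul', hμ]; simp
    have h4 := congrArg (fun z => (star μ * z).re) (sum_norm_kernel_sq_mul_char hN hμ)
    rw [← mul_assoc, h3, one_mul, Complex.ofReal_re, Finset.mul_sum, Complex.re_sum] at h4
    rw [← h4]
    refine Finset.sum_congr rfl fun y _ => ?_
    rw [mul_left_comm, Complex.re_ofReal_mul]
  have h5 : ∀ y : ZMod N, ‖kernel μ y‖ ^ 2 * ((1 - (star μ * ZMod.stdAddChar y).re) / 2)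
      = (‖kernel μ y‖ ^ 2 - ‖kernel μ y‖ ^ 2 * (star μ * ZMod.stdAddChar y).re) / 2 :=
    fun y => by ring
  rw [Finset.sum_congr rfl fun y _ => h5 y, ← Finset.sum_div, Finset.sum_sub_distrib, h2,
    sum_norm_kernel_sq hN hμ]

end Kernel

/-! ### Spectral analysis of a product of two reflections, and amplitude estimation. -/

section Spectral

variable {N : ℕ} [NeZero N] {M : Type} [Fintype M] [DecidableEq M]

/-- The amplitudes of phase estimation for `Q` on the input state `s`. -/
def finalAmp (Q : Matrix M M ℂ) (s : M → ℂ) (m : M) : ZMod N → ℂ :=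
  fourierMatrix N *ᵥ fun j => sineAmp j * (Q ^ j.val *ᵥ s) m

theorem finalAmp_add (Q : Matrix M M ℂ) (u v : M → ℂ) (m : M) (y : ZMod N) :
    finalAmp Q (u + v) m y = finalAmp Q u m y + finalAmp Q v m y := by
  rw [finalAmp, finalAmp, finalAmp, ← Pi.add_apply, ← Matrix.mulVec_add]
  congr 2
  funext j
  rw [Pi.add_apply, Matrix.mulVec_add, Pi.add_apply, mul_add]

theorem pow_mulVec_of_eigen {Q : Matrix M M ℂ} {μ : ℂ} {u : M → ℂ} (h : Q *ᵥ u = μ • u) (k : ℕ) :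
    Q ^ k *ᵥ u = μ ^ k • u := by
  induction k with
  | zero => simp
  | succ k ih => rw [pow_succ, ← Matrix.mulVec_mulVec, h, Matrix.mulVec_smul, ih, smul_smul,
      mul_comm, pow_succ]

/-- Phase kickback: the powers of `Q` act on `u` as scalars, which can be moved to the control
register. -/
theorem finalAmp_of_eigen {Q : Matrix M M ℂ} {μ : ℂ} {u : M → ℂ} (h : Q *ᵥ u = μ • u) (m : M)
    (y : ZMod N) : finalAmp Q u m y = kernel μ y * u m := by
  simp only [finalAmp, kernel, Matrix.mulVec, dotProduct, Finset.sum_mul]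
  refine Finset.sum_congr rfl fun j _ => ?_
  have h1 := congrFun (pow_mulVec_of_eigen h j.val) m
  simp only [Matrix.mulVec, dotProduct, Pi.smul_apply, smul_eq_mul] at h1
  rw [h1, phaseState]
  ring

theorem sum_norm_add_sq {X : Type*} [Fintype X] {u v : X → ℂ} (h : star u ⬝ᵥ v = 0) (a b : ℂ) :
    ∑ x, ‖a * u x + b * v x‖ ^ 2 = ‖a‖ ^ 2 * ∑ x, ‖u x‖ ^ 2 + ‖b‖ ^ 2 * ∑ x, ‖v x‖ ^ 2 := by
  have h' : star v ⬝ᵥ u = 0 := by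
    rw [Matrix.star_dotProduct, h, star_zero]
  have h1 : (fun x => a * u x + b * v x) = a • u + b • v := rfl
  have h2 := star_dotProduct_self (fun x => a * u x + b * v x)
  rw [h1, star_add, star_smul, star_smul, add_dotProduct, dotProduct_add, dotProduct_add] at h2
  simp only [smul_dotProduct, dotProduct_smul, h, h',
    star_dotProduct_self, smul_eq_mul] at h2
  apply Complex.ofReal_injective
  rw [← h2]
  push_cast
  rw [← Complex.conj_mul', ← Complex.conj_mul', Complex.star_def]
  ring

/-- The distribution of the outcome of phase estimation is a mixture of two kernels. -/
theorem sum_norm_finalAmp_sq {Q : Matrix M M ℂ} {s u v : M → ℂ} {μ ν : ℂ} (hs : s = u + v)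
    (huv : star u ⬝ᵥ v = 0) (hu : Q *ᵥ u = μ • u) (hv : Q *ᵥ v = ν • v) (y : ZMod N) :
    ∑ m, ‖finalAmp Q s m y‖ ^ 2
      = ‖kernel μ y‖ ^ 2 * ∑ m, ‖u m‖ ^ 2 + ‖kernel ν y‖ ^ 2 * ∑ m, ‖v m‖ ^ 2 := by
  rw [← sum_norm_add_sq huv]
  refine Finset.sum_congr rfl fun m _ => ?_
  rw [hs, finalAmp_add, finalAmp_of_eigen hu, finalAmp_of_eigen hv]

/-- The product of a reflection `G` with the reflection about the unit vector `s`. -/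
def groverMatrix (s : M → ℂ) (G : Matrix M M ℂ) : Matrix M M ℂ :=
  ((2 : ℂ) • Matrix.vecMulVec s (star s) - 1) * G

theorem groverMatrix_mulVec (s : M → ℂ) (G : Matrix M M ℂ) (v : M → ℂ) :
    groverMatrix s G *ᵥ v = (2 * (star s ⬝ᵥ (G *ᵥ v))) • s - G *ᵥ v := by
  rw [groverMatrix, ← Matrix.mulVec_mulVec, Matrix.sub_mulVec, Matrix.one_mulVec,
    Matrix.smul_mulVec, Matrix.vecMulVec_mulVec]
  ext m
  simp only [Pi.sub_apply, Pi.smul_apply, smul_eq_mul, MulOpposite.smul_eq_mul_unop,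
    MulOpposite.unop_op]
  ring

open scoped ComplexOrder in
/-- The two-dimensional invariant subspace of a product of two reflections. -/
theorem exists_eigen_decomposition {s : M → ℂ} {G : Matrix M M ℂ} (hs : star s ⬝ᵥ s = 1)
    (hG : Gᴴ = G) (hGG : G * G = 1) {c : ℝ} (hc1 : -1 ≤ c) (hc2 : c ≤ 1)
    (hc : star s ⬝ᵥ (G *ᵥ s) = c) :
    ∃ (u v : M → ℂ) (μ ν : ℂ), s = u + v ∧ star u ⬝ᵥ v = 0 ∧
      groverMatrix s G *ᵥ u = μ • u ∧ groverMatrix s G *ᵥ v = ν • v ∧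
      ‖μ‖ = 1 ∧ ‖ν‖ = 1 ∧ μ.re = c ∧ ν.re = c := by
  set t := G *ᵥ s with ht
  have hGt : G *ᵥ t = s := by rw [ht, Matrix.mulVec_mulVec, hGG, Matrix.one_mulVec]
  have hts : star t ⬝ᵥ s = c := by
    rw [Matrix.star_dotProduct, hc, Complex.star_def, Complex.conj_ofReal]
  have htt : star t ⬝ᵥ t = 1 := by
    nth_rewrite 1 [ht]
    rw [Matrix.star_mulVec, hG, ← Matrix.dotProduct_mulVec, hGt, hs]
  have hQs : groverMatrix s G *ᵥ s = (2 * (c : ℂ)) • s - t := by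
    rw [groverMatrix_mulVec, ← ht, hc]
  have hQt : groverMatrix s G *ᵥ t = s := by
    rw [groverMatrix_mulVec, hGt, hs]
    ext m
    simp
    ring
  have hr : (0 : ℝ) ≤ 1 - c ^ 2 := by nlinarith
  -- On the span of `s` and `t = G s` the product sends `s` to `2 c s - t` and `t` to `s`, with
  -- characteristic polynomial `x ^ 2 - 2 c x + 1`. Its roots coincide exactly when `c = ± 1`.
  rcases eq_or_lt_of_le hr with h0 | hpos
  · have hcc : (c : ℂ) * c = 1 := by
      rw [← Complex.ofReal_mul, ← Complex.ofReal_one]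
      congr 1
      linarith
    -- The squared norm of this vector is `1 - c ^ 2 = 0`, so `s` itself is an eigenvector.
    have htc : t - (c : ℂ) • s = 0 := by
      rw [← dotProduct_star_self_eq_zero, star_sub, star_smul,
        sub_dotProduct, dotProduct_sub, dotProduct_sub]
      simp only [smul_dotProduct, dotProduct_smul, hs, hc, hts, htt, smul_eq_mul,
        Complex.star_def, Complex.conj_ofReal]
      linear_combination -hcc
    have hcn : ‖(c : ℂ)‖ = 1 := by
      have : ‖(c : ℂ)‖ * ‖(c : ℂ)‖ = 1 := by rw [← norm_mul, hcc, norm_one]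
      nlinarith [norm_nonneg (c : ℂ)]
    refine ⟨s, 0, c, c, by simp, by simp, ?_, by simp, hcn, hcn, by simp, by simp⟩
    rw [hQs, sub_eq_zero.1 htc, two_mul, add_smul, add_sub_cancel_right]
  · set r := √(1 - c ^ 2) with hrdef
    have hrpos : 0 < r := Real.sqrt_pos.2 hpos
    have hrsq : r ^ 2 = 1 - c ^ 2 := Real.sq_sqrt hr
    set μ : ℂ := c + r * Complex.I with hμ
    set ν : ℂ := c - r * Complex.I with hν
    have hsum : μ + ν = 2 * c := by rw [hμ, hν]; ring
    have hrC : (r : ℂ) ^ 2 = 1 - (c : ℂ) ^ 2 := by exact_mod_cast hrsq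
    have hprod : μ * ν = 1 := by
      rw [hμ, hν]
      linear_combination hrC - (r : ℂ) ^ 2 * Complex.I_sq
    have hdiff : μ - ν ≠ 0 := by
      have : μ - ν = 2 * r * Complex.I := by rw [hμ, hν]; ring
      rw [this]
      have : (r : ℂ) ≠ 0 := by exact_mod_cast hrpos.ne'
      simp [this]
    have hstar : star ν = μ := by
      rw [hμ, hν, Complex.star_def]
      simp
    have hstar' : star μ = ν := by rw [← hstar, star_star]
    have hnμ : ‖μ‖ = 1 := by
      have h := Complex.conj_mul' μ
      rw [← Complex.star_def, hstar', mul_comm, hprod] at h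
      have h' : ‖μ‖ ^ 2 = 1 := by exact_mod_cast h.symm
      nlinarith [norm_nonneg μ]
    have hnν : ‖ν‖ = 1 := by rw [← hstar', norm_star, hnμ]
    have hQu : groverMatrix s G *ᵥ (s - ν • t) = μ • (s - ν • t) := by
      rw [Matrix.mulVec_sub, Matrix.mulVec_smul, hQs, hQt, ← hsum, smul_sub, smul_smul, hprod,
        one_smul, add_smul]
      abel
    have hQv : groverMatrix s G *ᵥ (s - μ • t) = ν • (s - μ • t) := by
      rw [Matrix.mulVec_sub, Matrix.mulVec_smul, hQs, hQt, ← hsum, smul_sub, smul_smul,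
        mul_comm ν, hprod, one_smul, add_smul]
      abel
    -- The coefficients are those for which `t` cancels in the sum and `s` gets weight one.
    refine ⟨(μ / (μ - ν)) • (s - ν • t), (-ν / (μ - ν)) • (s - μ • t), μ, ν, ?_, ?_, ?_, ?_, hnμ,
      hnν, by simp [hμ], by simp [hν]⟩
    · ext m
      simp only [Pi.add_apply, Pi.smul_apply, Pi.sub_apply, smul_eq_mul]
      field_simp
      ring
    · rw [star_smul, smul_dotProduct, dotProduct_smul, star_sub, star_smul, sub_dotProduct,
        dotProduct_sub, dotProduct_sub]
      simp only [smul_dotProduct, dotProduct_smul, hs, hc, hts, htt, smul_eq_mul, hstar]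
      have : (1 : ℂ) - μ * c - (μ * c - μ * (μ * 1)) = 0 := by
        linear_combination μ * hsum - hprod
      rw [this, mul_zero, mul_zero]
    · rw [Matrix.mulVec_smul, hQu, smul_comm]
    · rw [Matrix.mulVec_smul, hQv, smul_comm]

/-- Amplitude estimation: phase estimation for a product of two reflections. -/
theorem amplitude_estimation (hN : 2 ≤ N) {s : M → ℂ} {G : Matrix M M ℂ} (hs : star s ⬝ᵥ s = 1)
    (hG : Gᴴ = G) (hGG : G * G = 1) {F : ℝ} (hF0 : 0 ≤ F) (hF1 : F ≤ 1)
    (hF : star s ⬝ᵥ (G *ᵥ s) = ((1 - 2 * F ^ 2 : ℝ) : ℂ)) :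
    ∑ y : ZMod N, ∑ m, ‖finalAmp (groverMatrix s G) s m y‖ ^ 2 = 1 ∧
    ∑ y : ZMod N, (∑ m, ‖finalAmp (groverMatrix s G) s m y‖ ^ 2) * (estimate y - F) ^ 2
      ≤ (1 - Real.cos (Real.pi / N)) / 2 := by
  obtain ⟨u, v, μ, ν, hsuv, huv, hu, hv, hμ, hν, hμre, hνre⟩ :=
    exists_eigen_decomposition hs hG hGG (c := 1 - 2 * F ^ 2) (by nlinarith) (by nlinarith) hF
  have hone : ∑ m, ‖u m‖ ^ 2 + ∑ m, ‖v m‖ ^ 2 = 1 := by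
    have h1 := sum_norm_add_sq huv 1 1
    simp only [one_mul, norm_one, one_pow] at h1
    rw [← h1]
    apply Complex.ofReal_injective
    rw [Complex.ofReal_one, ← hs, star_dotProduct_self, hsuv]
    rfl
  have hp : 0 ≤ ∑ m, ‖u m‖ ^ 2 := Finset.sum_nonneg fun _ _ => sq_nonneg _
  have hq : 0 ≤ ∑ m, ‖v m‖ ^ 2 := Finset.sum_nonneg fun _ _ => sq_nonneg _
  simp only [sum_norm_finalAmp_sq hsuv huv hu hv]
  generalize ∑ m, ‖u m‖ ^ 2 = p at *
  generalize ∑ m, ‖v m‖ ^ 2 = q at *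
  constructor
  · rw [Finset.sum_add_distrib, ← Finset.sum_mul, ← Finset.sum_mul, sum_norm_kernel_sq hN hμ,
      sum_norm_kernel_sq hN hν, one_mul, one_mul, hone]
  · have e : ∀ y : ZMod N,
        (‖kernel μ y‖ ^ 2 * p + ‖kernel ν y‖ ^ 2 * q) * (estimate y - F) ^ 2
        = p * (‖kernel μ y‖ ^ 2 * (estimate y - F) ^ 2)
          + q * (‖kernel ν y‖ ^ 2 * (estimate y - F) ^ 2) := fun y => by ring
    rw [Finset.sum_congr rfl fun y _ => e y, Finset.sum_add_distrib, ← Finset.mul_sum,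
      ← Finset.mul_sum]
    have h1 := mul_le_mul_of_nonneg_left (sum_kernel_error_le hN hμ hF0 hμre) hp
    have h2 := mul_le_mul_of_nonneg_left (sum_kernel_error_le hN hν hF0 hνre) hq
    refine (add_le_add h1 h2).trans (le_of_eq ?_)
    rw [← add_mul, hone, one_mul]

/-- Markov's inequality for the square of the error `e`. -/
theorem one_sub_le_sum_ite {Y : Type*} [Fintype Y] {P e : Y → ℝ} {ε δ : ℝ} (hε : 0 < ε)
    (hP : ∀ y, 0 ≤ P y) (hP1 : ∑ y, P y = 1) (he : ∑ y, P y * e y ^ 2 ≤ δ * ε ^ 2) :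
    1 - δ ≤ ∑ y, if |e y| < ε then P y else 0 := by
  have key : ∀ y, P y * ε ^ 2 - P y * e y ^ 2 ≤ (if |e y| < ε then P y else 0) * ε ^ 2 := by
    intro y
    split_ifs with h
    · nlinarith [mul_nonneg (hP y) (sq_nonneg (e y))]
    · have h8 : ε ^ 2 ≤ e y ^ 2 := by
        rw [← sq_abs (e y)]
        exact pow_le_pow_left₀ hε.le (not_lt.1 h) 2
      nlinarith [mul_le_mul_of_nonneg_left h8 (hP y)]
  have h9 := Finset.sum_le_sum fun y (_ : y ∈ Finset.univ) => key y
  rw [Finset.sum_sub_distrib, ← Finset.sum_mul, ← Finset.sum_mul, hP1] at h9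
  have h10 : 0 < ε ^ 2 := by positivity
  refine le_of_mul_le_mul_right ?_ h10
  linarith

/-- The success probability of amplitude estimation. -/
theorem amplitude_estimation_success {ε : ℝ} (hε : 0 < ε) (hN2 : 2 ≤ N) (hN : 3 / ε ≤ N)
    {s : M → ℂ} {G : Matrix M M ℂ} (hs : star s ⬝ᵥ s = 1)
    (hG : Gᴴ = G) (hGG : G * G = 1) {F : ℝ} (hF0 : 0 ≤ F) (hF1 : F ≤ 1)
    (hF : star s ⬝ᵥ (G *ᵥ s) = ((1 - 2 * F ^ 2 : ℝ) : ℂ)) :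
    2 / 3 ≤ ∑ y : ZMod N, if |estimate y - F| < ε then
      ∑ m, ‖finalAmp (groverMatrix s G) s m y‖ ^ 2 else 0 := by
  obtain ⟨h1, h2⟩ := amplitude_estimation hN2 hs hG hGG hF0 hF1 hF
  have hN0 : (0 : ℝ) < N := lt_of_lt_of_le (by positivity) hN
  -- The left side is at most `π ^ 2 / (4 N ^ 2) ≤ π ^ 2 ε ^ 2 / 36`; the constant 3 in `3 / ε ≤ N`
  -- suffices since `π ^ 2 ≤ 10`.
  have hcos : (1 - Real.cos (Real.pi / N)) / 2 ≤ 1 / 3 * ε ^ 2 := by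
    have h3 := Real.one_sub_sq_div_two_le_cos (x := Real.pi / N)
    have h4 : Real.pi / N ≤ Real.pi * (ε / 3) := by
      rw [div_eq_mul_inv]
      refine mul_le_mul_of_nonneg_left ?_ Real.pi_pos.le
      rw [inv_le_comm₀ hN0 (by positivity), inv_div]
      exact hN
    have h5 : (Real.pi / N) ^ 2 ≤ (Real.pi * (ε / 3)) ^ 2 :=
      pow_le_pow_left₀ (by positivity) h4 2
    have h6 : Real.pi ^ 2 ≤ 10 := by nlinarith [Real.pi_lt_d2, Real.pi_pos]
    have h7 := mul_le_mul_of_nonneg_right h6 (sq_nonneg ε)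
    nlinarith
  refine le_trans (by norm_num) (one_sub_le_sum_ite hε
    (fun y => Finset.sum_nonneg fun _ _ => sq_nonneg _) h1 (h2.trans hcos))

end Spectral

end PhaseEstimation

namespace PureFidelity

open PhaseEstimation

/-! ### Operators on composite registers and elementary gates. -/

section Registers

variable {M J : Type}

/-- The vector on `M ⊗ J` with the components `f j` along the basis vectors of `J`. -/
def ofSlices (f : J → M → ℂ) : M × J → ℂ := fun w => f w.2 w.1

variable [Fintype M] [Fintype J]

theorem blockDiagonal_mulVec_ofSlices [DecidableEq J] (K : J → Matrix M M ℂ) (f : J → M → ℂ) :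
    Matrix.blockDiagonal K *ᵥ ofSlices f = ofSlices fun j => K j *ᵥ f j := by
  ext ⟨m, j⟩
  simp [Matrix.mulVec, dotProduct, ofSlices, Fintype.sum_prod_type, Matrix.blockDiagonal_apply]

theorem one_kronecker_mulVec_ofSlices [DecidableEq M] (K : Matrix J J ℂ) (f : J → M → ℂ) :
    ((1 : Matrix M M ℂ) ⊗ₖ K) *ᵥ ofSlices f
      = ofSlices fun y m => (K *ᵥ fun j => f j m) y := by
  ext ⟨m, j⟩
  simp [Matrix.mulVec, dotProduct, ofSlices, Fintype.sum_prod_type, Matrix.one_apply]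

variable [DecidableEq M] [DecidableEq J]

/-- The unitary that applies `K j` if the control register is in the basis state `j`. -/
def multiplexer (K : J → Matrix.unitaryGroup M ℂ) : Matrix.unitaryGroup (M × J) ℂ :=
  ⟨Matrix.blockDiagonal fun j => (K j : Matrix M M ℂ), by
    rw [Matrix.mem_unitaryGroup_iff', Matrix.star_eq_conjTranspose,
      Matrix.blockDiagonal_conjTranspose, ← Matrix.blockDiagonal_mul, ← Matrix.blockDiagonal_one]
    congr 1
    funext j
    exact Matrix.UnitaryGroup.star_mul_self (K j)⟩

theorem multiplexer_mulVec_ofSlices (K : J → Matrix.unitaryGroup M ℂ) (f : J → M → ℂ) :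
    (multiplexer K : Matrix (M × J) (M × J) ℂ) *ᵥ ofSlices f
      = ofSlices fun j => (K j : Matrix M M ℂ) *ᵥ f j :=
  blockDiagonal_mulVec_ofSlices _ f

/-- A unitary on the first of two systems. -/
def onFst (K : Matrix.unitaryGroup M ℂ) : Matrix.unitaryGroup (M × J) ℂ :=
  ⟨(K : Matrix M M ℂ) ⊗ₖ (1 : Matrix J J ℂ), Matrix.kronecker_mem_unitary K.2 (one_mem _)⟩

/-- A unitary on the second of two systems. -/
def onSnd (K : Matrix.unitaryGroup J ℂ) : Matrix.unitaryGroup (M × J) ℂ :=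
  ⟨(1 : Matrix M M ℂ) ⊗ₖ (K : Matrix J J ℂ), Matrix.kronecker_mem_unitary (one_mem _) K.2⟩

theorem onFst_inv (K : Matrix.unitaryGroup M ℂ) :
    (onFst K⁻¹ : Matrix.unitaryGroup (M × J) ℂ) = (onFst K)⁻¹ := by
  apply Subtype.ext
  simp only [onFst, Matrix.UnitaryGroup.inv_val, Matrix.star_eq_conjTranspose,
    Matrix.conjTranspose_kronecker, Matrix.conjTranspose_one]

theorem onSnd_inv (K : Matrix.unitaryGroup J ℂ) :
    (onSnd K⁻¹ : Matrix.unitaryGroup (M × J) ℂ) = (onSnd K)⁻¹ := by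
  apply Subtype.ext
  simp only [onSnd, Matrix.UnitaryGroup.inv_val, Matrix.star_eq_conjTranspose,
    Matrix.conjTranspose_kronecker, Matrix.conjTranspose_one]

theorem onSnd_mulVec_ofSlices (K : Matrix.unitaryGroup J ℂ) (f : J → M → ℂ) :
    (onSnd (M := M) K : Matrix (M × J) (M × J) ℂ) *ᵥ ofSlices f
      = ofSlices fun y m => ((K : Matrix J J ℂ) *ᵥ fun j => f j m) y :=
  one_kronecker_mulVec_ofSlices _ f

/-- The reflection that multiplies the basis states in `p` by `-1`. -/
def phaseFlip (p : M → Prop) [DecidablePred p] : Matrix.unitaryGroup M ℂ :=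
  ⟨Matrix.diagonal fun m => if p m then -1 else 1, by
    rw [Matrix.mem_unitaryGroup_iff', Matrix.star_eq_conjTranspose,
      Matrix.diagonal_conjTranspose, Matrix.diagonal_mul_diagonal, ← Matrix.diagonal_one]
    congr 1
    funext m
    by_cases h : p m <;> simp [h]⟩

theorem phaseFlip_inv (p : M → Prop) [DecidablePred p] : (phaseFlip p)⁻¹ = phaseFlip p := by
  apply Subtype.ext
  rw [Matrix.UnitaryGroup.inv_val, Matrix.star_eq_conjTranspose, phaseFlip]
  dsimp only
  rw [Matrix.diagonal_conjTranspose]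
  congr 1
  funext m
  by_cases h : p m <;> simp [h]

theorem phaseFlip_ne (m₀ : M) :
    (phaseFlip (fun m => m ≠ m₀) : Matrix M M ℂ)
      = (2 : ℂ) • Matrix.vecMulVec (Pi.single m₀ 1) (star (Pi.single m₀ 1)) - 1 := by
  ext i j
  change Matrix.diagonal _ i j = _
  rw [Matrix.diagonal_apply, Matrix.sub_apply, Matrix.smul_apply,
    Matrix.vecMulVec_apply, Matrix.one_apply, Pi.star_apply]
  by_cases hij : i = j
  · subst hij
    by_cases h : i = m₀
    · subst h; simp; norm_num
    · simp [h]
  · by_cases h : i = m₀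
    · subst h
      simp [hij, Ne.symm hij]
    · simp [h, hij]

/-- The unitary that permutes the basis states. -/
def permute (σ : Equiv.Perm M) : Matrix.unitaryGroup M ℂ :=
  ⟨σ.permMatrix ℂ, by
    rw [Matrix.mem_unitaryGroup_iff', Matrix.star_eq_conjTranspose,
      Matrix.conjTranspose_permMatrix, ← Matrix.permMatrix_mul, mul_inv_cancel,
      Matrix.permMatrix_one]⟩

/-- Every unit vector can be prepared from a given basis state. -/
theorem exists_unitary_col (j₀ : J) (a : J → ℂ) (ha : ∑ j, ‖a j‖ ^ 2 = 1) :
    ∃ K : Matrix.unitaryGroup J ℂ, ∀ j, (K : Matrix J J ℂ) j j₀ = a j := by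
  have hnorm : ‖WithLp.toLp 2 a‖ = 1 := by
    rw [EuclideanSpace.norm_eq, Real.sqrt_eq_one]
    exact ha
  obtain ⟨b, hb⟩ := Orthonormal.exists_orthonormalBasis_extension_of_card_eq (𝕜 := ℂ)
    (E := EuclideanSpace ℂ J) (ι := J) (by simp) (v := fun _ => WithLp.toLp 2 a) (s := {j₀}) (by
      refine ⟨fun _ => hnorm, fun i j hij => ?_⟩
      exact absurd (Subsingleton.elim i j) hij)
  refine ⟨⟨_, (EuclideanSpace.basisFun J ℂ).toMatrix_orthonormalBasis_mem_unitary b⟩,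
    fun j => ?_⟩
  simp [Module.Basis.toMatrix_apply, hb j₀ rfl]

end Registers

/-! ### The query algorithm, its cost and its final state. -/

section Algorithm

variable {A B B' : Type} [Fintype A] [DecidableEq A] [Fintype B] [DecidableEq B]
  [Fintype B'] [DecidableEq B']

/-- The exchange of the two copies of `A`. -/
def swapFst : Equiv.Perm ((A × B) × (A × B')) where
  toFun m := ((m.2.1, m.1.2), (m.1.1, m.2.2))
  invFun m := ((m.2.1, m.1.2), (m.1.1, m.2.2))
  left_inv _ := rfl
  right_inv _ := rfl

/-- The circuit `U† · SWAP · V · U`, whose amplitude of staying at `|0⟩` in the first register has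
the fidelity as its norm. -/
def overlapUnitary (U : Matrix.unitaryGroup (A × B) ℂ) (V : Matrix.unitaryGroup (A × B') ℂ) :
    Matrix.unitaryGroup ((A × B) × (A × B')) ℂ :=
  (onFst U)⁻¹ * permute swapFst * onSnd V * onFst U

/-- The registers on which `U` acts. -/
def regU (X Y J : Type) : (X × Y) × J ≃ X × (Y × J) := Equiv.prodAssoc X Y J

/-- The registers on which `V` acts. -/
def regV (X Y J : Type) : (X × Y) × J ≃ Y × (X × J) :=
  ((Equiv.prodComm X Y).prodCongr (Equiv.refl J)).trans (Equiv.prodAssoc Y X J)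

section Queries

variable {X Y J : Type} [Fintype X] [DecidableEq X] [Fintype Y] [DecidableEq Y]
  [Fintype J] [DecidableEq J]

theorem applyOn_regU_mulVec (K : Matrix.unitaryGroup X ℂ) (f : J → X × Y → ℂ) :
    applyOn (regU X Y J) (K : Matrix X X ℂ) *ᵥ ofSlices f
      = ofSlices fun j => (onFst (J := Y) K : Matrix (X × Y) (X × Y) ℂ) *ᵥ f j := by
  rw [← blockDiagonal_mulVec_ofSlices]
  congr 1
  ext ⟨⟨x, y⟩, j⟩ ⟨⟨x', y'⟩, j'⟩
  simp only [applyOn, regU, onFst, Matrix.reindex_apply, Matrix.submatrix_apply,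
    Matrix.blockDiagonal_apply, Equiv.symm_symm, Equiv.prodAssoc_apply,
    Matrix.kroneckerMap_apply, Matrix.one_apply, Prod.mk.injEq]
  by_cases h : y = y' <;> by_cases h' : j = j' <;> simp [h, h']

theorem applyOn_regV_mulVec (K : Matrix.unitaryGroup Y ℂ) (f : J → X × Y → ℂ) :
    applyOn (regV X Y J) (K : Matrix Y Y ℂ) *ᵥ ofSlices f
      = ofSlices fun j => (onSnd (M := X) K : Matrix (X × Y) (X × Y) ℂ) *ᵥ f j := by
  rw [← blockDiagonal_mulVec_ofSlices]
  congr 1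
  ext ⟨⟨x, y⟩, j⟩ ⟨⟨x', y'⟩, j'⟩
  simp only [applyOn, regV, onSnd, Matrix.reindex_apply, Matrix.submatrix_apply,
    Matrix.blockDiagonal_apply, Equiv.symm_symm, Equiv.trans_apply, Equiv.prodCongr_apply,
    Prod.map_apply, Equiv.prodComm_apply, Prod.swap_prod_mk, Equiv.refl_apply,
    Equiv.prodAssoc_apply, Matrix.kroneckerMap_apply, Matrix.one_apply, Prod.mk.injEq]
  by_cases h : x = x' <;> by_cases h' : j = j' <;> simp [h, h']

theorem oracle_false (K : Matrix.unitaryGroup X ℂ) : oracle false K = (K : Matrix X X ℂ) := rfl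

theorem oracle_true (K : Matrix.unitaryGroup X ℂ) :
    oracle true K = ((K⁻¹ : Matrix.unitaryGroup X ℂ) : Matrix X X ℂ) := rfl

end Queries

variable {N : ℕ} [NeZero N]

/-- One round: a Grover iteration if the control register holds a number above `t`, and the
identity otherwise. -/
def groverRound (x₀ : A × B) (m₀ : (A × B) × (A × B')) (t : ℕ) :
    List (Step (A × B) (A × B') (((A × B) × (A × B')) × ZMod N)) :=
  [.queryU false _ (regU _ _ _), .queryV false _ (regV _ _ _),
    .gate (multiplexer fun _ => permute swapFst), .queryU true _ (regU _ _ _),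
    .gate (multiplexer fun j => if t < j.val then phaseFlip (fun m => m.1 = x₀) else 1),
    .queryU false _ (regU _ _ _), .gate (multiplexer fun _ => (permute swapFst)⁻¹),
    .queryV true _ (regV _ _ _), .queryU true _ (regU _ _ _),
    .gate (multiplexer fun j => if t < j.val then phaseFlip (fun m => m ≠ m₀) else 1)]

/-- The Grover iteration of the circuit `overlapUnitary U V`. -/
def overlapGrover (x₀ : A × B) (m₀ : (A × B) × (A × B')) (U : Matrix.unitaryGroup (A × B) ℂ)
    (V : Matrix.unitaryGroup (A × B') ℂ) : Matrix.unitaryGroup ((A × B) × (A × B')) ℂ :=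
  phaseFlip (fun m => m ≠ m₀) * ((overlapUnitary U V)⁻¹ * phaseFlip (fun m => m.1 = x₀)
    * overlapUnitary U V)

/-- The state of the workspace after a list of steps. -/
def run {X Y W : Type} [Fintype X] [DecidableEq X] [Fintype Y] [DecidableEq Y] [Fintype W]
    [DecidableEq W] (U : Matrix.unitaryGroup X ℂ) (V : Matrix.unitaryGroup Y ℂ)
    (l : List (Step X Y W)) (v : W → ℂ) : W → ℂ :=
  l.foldl (fun v s => s.toMatrix U V *ᵥ v) v

/-- Only the two phase flips are conditioned on the control register. Without them the circuit and
its inverse cancel, so the oracle queries themselves need no control. -/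
theorem run_groverRound (x₀ : A × B) (m₀ : (A × B) × (A × B'))
    (U : Matrix.unitaryGroup (A × B) ℂ) (V : Matrix.unitaryGroup (A × B') ℂ) (t : ℕ)
    (f : ZMod N → (A × B) × (A × B') → ℂ) :
    run U V (groverRound x₀ m₀ t) (ofSlices f) = ofSlices fun j =>
      ((if t < j.val then overlapGrover x₀ m₀ U V else 1 :
        Matrix.unitaryGroup ((A × B) × (A × B')) ℂ) :
        Matrix ((A × B) × (A × B')) ((A × B) × (A × B')) ℂ) *ᵥ f j := by
  simp only [run, groverRound, List.foldl_cons, List.foldl_nil, Step.toMatrix, oracle_false,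
    oracle_true, applyOn_regU_mulVec, applyOn_regV_mulVec, multiplexer_mulVec_ofSlices]
  simp only [Matrix.mulVec_mulVec, ← Matrix.UnitaryGroup.mul_val]
  congr 1
  funext j
  congr 2
  by_cases h : t < j.val
  · simp only [h, if_true, overlapGrover, overlapUnitary, onFst_inv, onSnd_inv]
    group
  · simp only [h, if_false, onFst_inv, onSnd_inv]
    group

theorem run_append {X Y W : Type} [Fintype X] [DecidableEq X] [Fintype Y] [DecidableEq Y]
    [Fintype W] [DecidableEq W] (U : Matrix.unitaryGroup X ℂ) (V : Matrix.unitaryGroup Y ℂ)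
    (l l' : List (Step X Y W)) (v : W → ℂ) :
    run U V (l ++ l') v = run U V l' (run U V l v) :=
  List.foldl_append

/-- The branch `j` is active in the rounds `t < j` only. -/
theorem run_groverRounds (x₀ : A × B) (m₀ : (A × B) × (A × B'))
    (U : Matrix.unitaryGroup (A × B) ℂ) (V : Matrix.unitaryGroup (A × B') ℂ) (k : ℕ)
    (f : ZMod N → (A × B) × (A × B') → ℂ) :
    run U V ((List.range k).flatMap (groverRound x₀ m₀)) (ofSlices f) = ofSlices fun j =>
      (overlapGrover x₀ m₀ U V : Matrix ((A × B) × (A × B')) ((A × B) × (A × B')) ℂ)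
        ^ (min k j.val) *ᵥ f j := by
  induction k with
  | zero => simp [run]
  | succ k ih =>
    rw [List.range_succ, List.flatMap_append, run_append, ih, List.flatMap_singleton,
      run_groverRound]
    congr 1
    funext j
    rw [Matrix.mulVec_mulVec]
    congr 1
    by_cases h : k < j.val
    · rw [if_pos h, min_eq_left h.le, min_eq_left (Nat.succ_le_of_lt h), pow_succ']
    · rw [if_neg h, min_eq_right (not_lt.1 h), min_eq_right ((not_lt.1 h).trans (Nat.le_succ k)),
        Matrix.UnitaryGroup.one_val, one_mul]

/-- Amplitude estimation for the circuit `overlapUnitary`, with the control register prepared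
by `K`. -/
def fidelityAlgorithm (x₀ : A × B) (m₀ : (A × B) × (A × B'))
    (K : Matrix.unitaryGroup (ZMod N) ℂ) : QueryAlgorithm (A × B) (A × B') where
  W := ((A × B) × (A × B')) × ZMod N
  fintypeW := inferInstance
  decEqW := inferInstance
  init := (m₀, 0)
  steps := [.gate (onSnd K)] ++ (List.range N).flatMap (groverRound x₀ m₀)
    ++ [.gate (onSnd ⟨fourierMatrix N, fourierMatrix_mem⟩)]
  output w := estimate w.2

theorem fidelityAlgorithm_queryCount (x₀ : A × B) (m₀ : (A × B) × (A × B'))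
    (K : Matrix.unitaryGroup (ZMod N) ℂ) : (fidelityAlgorithm x₀ m₀ K).queryCount = 6 * N := by
  have h : ∀ k, (((List.range k).flatMap (groverRound (N := N) x₀ m₀)).map Step.queries).sum
      = 6 * k := by
    intro k
    induction k with
    | zero => simp
    | succ k ih =>
      rw [List.range_succ, List.flatMap_append, List.map_append, List.sum_append, ih,
        List.flatMap_singleton]
      simp [groverRound, Step.queries]
      ring
  rw [QueryAlgorithm.queryCount, fidelityAlgorithm]
  simp only [List.map_append, List.sum_append, h]
  simp [Step.queries]

theorem fidelityAlgorithm_finalState (x₀ : A × B) (m₀ : (A × B) × (A × B'))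
    {K : Matrix.unitaryGroup (ZMod N) ℂ}
    (hK : ∀ j, (K : Matrix (ZMod N) (ZMod N) ℂ) j 0 = sineAmp j)
    (U : Matrix.unitaryGroup (A × B) ℂ) (V : Matrix.unitaryGroup (A × B') ℂ) :
    (fidelityAlgorithm x₀ m₀ K).finalState U V
      = ofSlices fun y m => finalAmp (overlapGrover x₀ m₀ U V).1 (Pi.single m₀ 1) m y := by
  have h0 : (Pi.single (m₀, 0) 1 : ((A × B) × (A × B')) × ZMod N → ℂ)
      = ofSlices fun j m => (Pi.single m₀ 1 : _ → ℂ) m * (Pi.single 0 1 : ZMod N → ℂ) j := by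
    ext ⟨m, j⟩
    by_cases hm : m = m₀ <;> by_cases hj : j = 0 <;> simp [ofSlices, hm, hj]
  have h1 : (fidelityAlgorithm x₀ m₀ K).finalState U V
      = run U V ([.gate (onSnd K)] ++ (List.range N).flatMap (groverRound x₀ m₀)
        ++ [.gate (onSnd ⟨fourierMatrix N, fourierMatrix_mem⟩)]) (Pi.single (m₀, 0) 1) := rfl
  have h2 : run U V [.gate (onSnd K)]
      (Pi.single (m₀, 0) 1 : ((A × B) × (A × B')) × ZMod N → ℂ)
      = ofSlices fun j => (sineAmp j : ℂ) • (Pi.single m₀ 1 : _ → ℂ) := by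
    rw [run, List.foldl_cons, List.foldl_nil, Step.toMatrix, h0, onSnd_mulVec_ofSlices]
    congr 1
    funext j m
    simp [Matrix.mulVec, dotProduct, Pi.single_apply, hK]
  rw [h1, run_append, run_append, h2, run_groverRounds, run, List.foldl_cons, List.foldl_nil,
    Step.toMatrix, onSnd_mulVec_ofSlices]
  congr 1
  funext y m
  rw [finalAmp]
  congr 2
  funext j
  -- Labels of the control register are below `N`, so after `N` rounds the branch `j` has received
  -- the full power `j`.
  rw [min_eq_right (ZMod.val_lt j).le, Matrix.mulVec_smul]
  rfl

end Algorithm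

/-! ### Fidelity as an amplitude, and the success probability. -/

section Overlap

variable {A B B' : Type} [Fintype A] [DecidableEq A] [Fintype B] [DecidableEq B]
  [Fintype B'] [DecidableEq B']

theorem PreparesPurificationOf.sum_mul_star {a₀ : A} {b₀ : B} {U : Matrix.unitaryGroup (A × B) ℂ}
    {φ : EuclideanSpace ℂ A} (h : PreparesPurificationOf a₀ b₀ U φ) (i j : A) :
    ∑ b, U.1 (i, b) (a₀, b₀) * star (U.1 (j, b) (a₀, b₀)) = φ i * star (φ j) := by
  have h1 := congrFun (congrFun h i) j
  simpa [partialTrace, ketbra, Matrix.vecMulVec_apply] using h1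

/-- After the swap, `U†` meets the old `B` register together with the `A` part of `V`'s output.
Projecting on `x₀` leaves a sum over `b` that is an entry of the partial trace of the state prepared
by `U`. -/
theorem overlapUnitary_mulVec_single (U : Matrix.unitaryGroup (A × B) ℂ)
    (V : Matrix.unitaryGroup (A × B') ℂ) (x₀ : A × B) (y₀ : A × B') (a : A) (b' : B') :
    ((overlapUnitary U V).1 *ᵥ Pi.single (x₀, y₀) 1) (x₀, (a, b'))
      = ∑ c, ∑ b, star (U.1 (c, b) x₀) * (U.1 (a, b) x₀ * V.1 (c, b') y₀) := by
  have hU : (onFst (J := A × B') U).1 *ᵥ Pi.single (x₀, y₀) 1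
      = fun m => U.1 m.1 x₀ * (Pi.single y₀ 1 : A × B' → ℂ) m.2 := by
    ext m
    simp [onFst, Matrix.one_apply, Pi.single_apply]
  have hV : (onSnd (M := A × B) V).1 *ᵥ
      (fun m => U.1 m.1 x₀ * (Pi.single y₀ 1 : A × B' → ℂ) m.2)
      = fun m => U.1 m.1 x₀ * V.1 m.2 y₀ := by
    ext ⟨x, y⟩
    simp [onSnd, Matrix.mulVec, dotProduct, Fintype.sum_prod_type_right, Matrix.one_apply,
      Pi.single_apply, mul_comm]
  have hS : (permute (swapFst (A := A) (B := B) (B' := B'))).1 *ᵥ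
      (fun m => U.1 m.1 x₀ * V.1 m.2 y₀)
      = fun m => U.1 (m.2.1, m.1.2) x₀ * V.1 (m.1.1, m.2.2) y₀ :=
    Matrix.permMatrix_mulVec _
  rw [overlapUnitary]
  simp only [Matrix.UnitaryGroup.mul_val, ← Matrix.mulVec_mulVec, hU, hV, hS]
  rw [← onFst_inv]
  simp only [onFst, Matrix.mulVec, dotProduct, Matrix.kroneckerMap_apply,
    Matrix.UnitaryGroup.inv_val, Matrix.star_apply, Matrix.one_apply]
  rw [Fintype.sum_prod_type, Fintype.sum_prod_type]
  simp

/-- The amplitude splits into `φ a` and a factor depending on `b'` only. The former has total weight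
1; for the latter, summing over `b'` takes the partial trace for `V` and yields `⟨φ|ψ⟩⟨ψ|φ⟩`. -/
theorem sum_norm_overlap_sq {a₀ : A} {b₀ : B} {b₀' : B'} {U : Matrix.unitaryGroup (A × B) ℂ}
    {V : Matrix.unitaryGroup (A × B') ℂ} {φ ψ : EuclideanSpace ℂ A} (hφ : ‖φ‖ = 1)
    (hU : PreparesPurificationOf a₀ b₀ U φ) (hV : PreparesPurificationOf a₀ b₀' V ψ) :
    ∑ y, ‖((overlapUnitary U V).1 *ᵥ Pi.single ((a₀, b₀), (a₀, b₀')) 1) ((a₀, b₀), y)‖ ^ 2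
      = fidelity φ ψ ^ 2 := by
  have hamp : ∀ a b', ((overlapUnitary U V).1 *ᵥ Pi.single ((a₀, b₀), (a₀, b₀')) 1)
      ((a₀, b₀), (a, b')) = φ a * ∑ c, star (φ c) * V.1 (c, b') (a₀, b₀') := by
    intro a b'
    rw [overlapUnitary_mulVec_single, Finset.mul_sum]
    refine Finset.sum_congr rfl fun c _ => ?_
    rw [← mul_assoc, ← hU.sum_mul_star, Finset.sum_mul]
    exact Finset.sum_congr rfl fun b _ => by ring
  have hsum : ∑ b', ‖∑ c, star (φ c) * V.1 (c, b') (a₀, b₀')‖ ^ 2 = fidelity φ ψ ^ 2 := by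
    apply Complex.ofReal_injective
    rw [fidelity, PiLp.inner_apply, Complex.ofReal_sum]
    simp only [Complex.ofReal_pow, ← Complex.mul_conj', map_sum, Finset.sum_mul_sum]
    rw [Finset.sum_comm]
    refine Finset.sum_congr rfl fun c _ => ?_
    rw [Finset.sum_comm]
    refine Finset.sum_congr rfl fun d _ => ?_
    have h := hV.sum_mul_star c d
    simp only [RCLike.inner_apply, Complex.star_def, map_mul, Complex.conj_conj] at h ⊢
    calc _ = ∑ b', star (φ c) * φ d *
          (V.1 (c, b') (a₀, b₀') * (starRingEnd ℂ) (V.1 (d, b') (a₀, b₀'))) :=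
          Finset.sum_congr rfl fun b' _ => by rw [Complex.star_def]; ring
      _ = _ := by rw [← Finset.mul_sum, h, Complex.star_def]; ring
  have hone : ∑ a, ‖φ a‖ ^ 2 = 1 := by
    rw [← EuclideanSpace.norm_sq_eq, hφ, one_pow]
  rw [Fintype.sum_prod_type]
  simp only [hamp, norm_mul, mul_pow]
  simp only [← Finset.mul_sum, hsum]
  rw [← Finset.sum_mul, hone, one_mul]

theorem overlapGrover_eq (x₀ : A × B) (m₀ : (A × B) × (A × B')) (U : Matrix.unitaryGroup (A × B) ℂ)
    (V : Matrix.unitaryGroup (A × B') ℂ) :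
    (overlapGrover x₀ m₀ U V).1 = groverMatrix (Pi.single m₀ 1)
      ((overlapUnitary U V)⁻¹ * phaseFlip (fun m : (A × B) × (A × B') => m.1 = x₀) * overlapUnitary U V).1 := by
  rw [groverMatrix, ← phaseFlip_ne]
  rfl

/-- Moving `P` across the inner product leaves the expectation of a sign flip in a unit vector: the
total weight minus twice the flipped weight. -/
theorem conj_phaseFlip_expectation {X Y : Type} [Fintype X] [DecidableEq X] [Fintype Y]
    [DecidableEq Y] (P : Matrix.unitaryGroup (X × Y) ℂ) (x₀ : X) {s : X × Y → ℂ}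
    (hs : star s ⬝ᵥ s = 1) :
    star s ⬝ᵥ ((P⁻¹ * phaseFlip (fun m : X × Y => m.1 = x₀) * P).1 *ᵥ s)
      = ((1 - 2 * ∑ y, ‖(P.1 *ᵥ s) (x₀, y)‖ ^ 2 : ℝ) : ℂ) := by
  have h1 : ∑ m, ‖(P.1 *ᵥ s) m‖ ^ 2 = 1 := by
    apply Complex.ofReal_injective
    rw [← star_dotProduct_self, star_mulVec_dotProduct_mulVec P.2, hs, Complex.ofReal_one]
  have h2 : star s ⬝ᵥ ((P⁻¹ * phaseFlip (fun m : X × Y => m.1 = x₀) * P).1 *ᵥ s)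
      = star (P.1 *ᵥ s) ⬝ᵥ ((phaseFlip fun m : X × Y => m.1 = x₀).1 *ᵥ (P.1 *ᵥ s)) := by
    simp only [Matrix.UnitaryGroup.mul_val, Matrix.UnitaryGroup.inv_val, ← Matrix.mulVec_mulVec]
    rw [Matrix.star_mulVec, ← Matrix.dotProduct_mulVec, Matrix.star_eq_conjTranspose]
  rw [h2, ← h1]
  generalize P.1 *ᵥ s = w
  have h3 : ∀ m : X × Y, star w m * ((phaseFlip fun m : X × Y => m.1 = x₀).1 *ᵥ w) m
      = ((‖w m‖ ^ 2 - 2 * (if m.1 = x₀ then ‖w m‖ ^ 2 else 0) : ℝ) : ℂ) := by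
    intro m
    have h4 : ((phaseFlip fun m : X × Y => m.1 = x₀).1 *ᵥ w) m
        = (if m.1 = x₀ then -1 else 1) * w m := Matrix.mulVec_diagonal _ _ _
    have h5 := Complex.conj_mul' (w m)
    rw [h4, Pi.star_apply, Complex.star_def]
    by_cases h : m.1 = x₀
    · simp only [h, if_true]
      push_cast
      linear_combination -h5
    · simp only [h, if_false]
      push_cast
      linear_combination h5
  rw [dotProduct, Finset.sum_congr rfl fun m _ => h3 m, ← Complex.ofReal_sum,
    Finset.sum_sub_distrib, ← Finset.mul_sum]
  congr 3
  rw [Fintype.sum_prod_type_right]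
  simp

theorem fidelityAlgorithm_success {N : ℕ} [NeZero N] {ε : ℝ} (hε : 0 < ε) (hN2 : 2 ≤ N)
    (hN : 3 / ε ≤ N) {K : Matrix.unitaryGroup (ZMod N) ℂ}
    (hK : ∀ j, (K : Matrix (ZMod N) (ZMod N) ℂ) j 0 = sineAmp j)
    {a₀ : A} {b₀ : B} {b₀' : B'} {U : Matrix.unitaryGroup (A × B) ℂ}
    {V : Matrix.unitaryGroup (A × B') ℂ} {φ ψ : EuclideanSpace ℂ A} (hφ : ‖φ‖ = 1) (hψ : ‖ψ‖ = 1)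
    (hU : PreparesPurificationOf a₀ b₀ U φ) (hV : PreparesPurificationOf a₀ b₀' V ψ) :
    2 / 3 ≤ (fidelityAlgorithm (a₀, b₀) ((a₀, b₀), (a₀, b₀')) K).prob U V
      {x : ℝ | |x - fidelity φ ψ| < ε} := by
  set m₀ : (A × B) × (A × B') := ((a₀, b₀), (a₀, b₀')) with hm₀
  set P := overlapUnitary U V with hP
  set Z : Matrix.unitaryGroup ((A × B) × (A × B')) ℂ :=
    phaseFlip (fun m => m.1 = (a₀, b₀)) with hZ
  have hs : star (Pi.single m₀ 1 : _ → ℂ) ⬝ᵥ Pi.single m₀ 1 = 1 := by simp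
  -- A unitary equal to its own inverse is both Hermitian and an involution, which gives `hG` and
  -- `hGG`.
  have hinv : (P⁻¹ * Z * P)⁻¹ = P⁻¹ * Z * P := by
    have := phaseFlip_inv (fun m : (A × B) × (A × B') => m.1 = (a₀, b₀))
    rw [← hZ] at this
    rw [mul_inv_rev, mul_inv_rev, inv_inv, this, mul_assoc]
  have hG : ((P⁻¹ * Z * P).1)ᴴ = (P⁻¹ * Z * P).1 := by
    rw [← Matrix.star_eq_conjTranspose, ← Matrix.UnitaryGroup.inv_val, hinv]
  have hGG : (P⁻¹ * Z * P).1 * (P⁻¹ * Z * P).1 = 1 := by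
    nth_rewrite 1 [← hG]
    exact Matrix.UnitaryGroup.star_mul_self _
  have hF0 : 0 ≤ fidelity φ ψ := norm_nonneg _
  have hF1 : fidelity φ ψ ≤ 1 := by
    simpa [fidelity, hφ, hψ] using norm_inner_le_norm (𝕜 := ℂ) φ ψ
  have hF : star (Pi.single m₀ 1 : _ → ℂ) ⬝ᵥ ((P⁻¹ * Z * P).1 *ᵥ Pi.single m₀ 1)
      = ((1 - 2 * fidelity φ ψ ^ 2 : ℝ) : ℂ) := by
    rw [hZ, conj_phaseFlip_expectation P _ hs, hP, hm₀, sum_norm_overlap_sq hφ hU hV]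
  refine (amplitude_estimation_success hε hN2 hN hs hG hGG hF0 hF1 hF).trans
    (le_of_eq ?_)
  rw [QueryAlgorithm.prob, fidelityAlgorithm_finalState _ _ hK, overlapGrover_eq]
  -- The output depends on the control outcome `y` alone, so the Born sum is grouped by `y`.
  refine Eq.trans ?_ (Fintype.sum_prod_type_right (α₁ := (A × B) × (A × B')) (α₂ := ZMod N) _).symm
  refine Finset.sum_congr rfl fun y _ => ?_
  by_cases h : |estimate y - fidelity φ ψ| < ε
  · rw [if_pos h]
    refine Finset.sum_congr rfl fun m _ => ?_
    symm
    exact Set.indicator_of_mem (M := ℝ) (s := (fidelityAlgorithm (a₀, b₀) m₀ K).output ⁻¹'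
      {x : ℝ | |x - fidelity φ ψ| < ε}) (a := (m, y)) h _
  · rw [if_neg h]
    refine (Finset.sum_eq_zero fun m _ => ?_).symm
    exact Set.indicator_of_notMem (M := ℝ) (s := (fidelityAlgorithm (a₀, b₀) m₀ K).output ⁻¹'
      {x : ℝ | |x - fidelity φ ψ| < ε}) (a := (m, y)) h _

end Overlap

end PureFidelity

end

/-! ### Choice of constants. -/

theorem corollary5p1 :
    ∃ C : ℝ, 0 < C ∧
      ∀ (A B B' : Type) [Fintype A] [DecidableEq A] [Fintype B] [DecidableEq B]
        [Fintype B'] [DecidableEq B'] (a₀ : A) (b₀ : B) (b₀' : B') (ε : ℝ), 0 < ε → ε < 1 →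
        ∃ 𝒜 : PureFidelity.QueryAlgorithm (A × B) (A × B'),
          (𝒜.queryCount : ℝ) ≤ C / ε ∧
          ∀ (U : Matrix.unitaryGroup (A × B) ℂ) (V : Matrix.unitaryGroup (A × B') ℂ)
            (φ ψ : EuclideanSpace ℂ A), ‖φ‖ = 1 → ‖ψ‖ = 1 →
            PureFidelity.PreparesPurificationOf a₀ b₀ U φ →
            PureFidelity.PreparesPurificationOf a₀ b₀' V ψ →
            2 / 3 ≤ 𝒜.prob U V {x : ℝ | |x - PureFidelity.fidelity φ ψ| < ε} := by
  -- Six queries in each of `N` rounds, with `N ≤ 4 / ε`.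
  refine ⟨24, by norm_num, ?_⟩
  intro A B B' _ _ _ _ _ _ a₀ b₀ b₀' ε hε hε1
  obtain ⟨N, hNdef⟩ : ∃ N : ℕ, N = ⌈3 / ε⌉₊ := ⟨_, rfl⟩
  have hN : 3 / ε ≤ N := hNdef ▸ Nat.le_ceil _
  have h3 : 3 ≤ 3 / ε := by rw [le_div_iff₀ hε]; linarith
  have hN3 : 3 ≤ N := by exact_mod_cast h3.trans hN
  have : NeZero N := ⟨by omega⟩
  -- Here `ε < 1` absorbs the rounding error of the ceiling into `1 / ε`.
  have hNle : (N : ℝ) ≤ 4 / ε := by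
    have h4 : (N : ℝ) < 3 / ε + 1 := hNdef ▸ Nat.ceil_lt_add_one (by positivity)
    have h5 : 1 ≤ 1 / ε := by rw [le_div_iff₀ hε]; linarith
    have h6 : 4 / ε = 3 / ε + 1 / ε := by ring
    linarith
  obtain ⟨K, hK⟩ := PureFidelity.exists_unitary_col (0 : ZMod N)
    (fun j => (PhaseEstimation.sineAmp j : ℂ)) (by
      rw [← PhaseEstimation.sum_sineAmp_sq (N := N) (by omega)]
      refine Finset.sum_congr rfl fun j _ => ?_
      rw [Complex.norm_real, Real.norm_eq_abs, sq_abs])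
  refine ⟨PureFidelity.fidelityAlgorithm (a₀, b₀) ((a₀, b₀), (a₀, b₀')) K, ?_, ?_⟩
  · rw [PureFidelity.fidelityAlgorithm_queryCount]
    have h7 : (24 : ℝ) / ε = 6 * (4 / ε) := by ring
    push_cast
    linarith
  · intro U V φ ψ hφ hψ hU hV
    exact PureFidelity.fidelityAlgorithm_success hε (by omega) hN hK hφ hψ hU hV
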